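/- Let $n\ge 1$ and let $M=\mathbb R^n$ with its canonical flat torsion-free connection $\nabla$ and a diagonal Riemannian metric $\langle\,,\rangle=\mathrm{Diag}(\mu_1,\dots,\mu_n)$, i.e. $\mu_1,\dots,\mu_n$ are smooth positive functions on $\mathbb R^n$. For a manifold $N$ with a flat torsion-free connection $\nabla$ and a Riemannian metric $\langle\,,\rangle$, denote by $X^h$ and $X^v$ the horizontal (with respect to $\nabla$) and vertical lifts to $TN$ of a vector field $X$ on $N$. The tangent bundle $TN$ carries the Hermitian structure $(J_1,g_1)$ and the flat torsion-free connection $\nabla^1$ given by $$J_1X^h=X^v,\quad J_1X^v=-X^h,\quad g_1(X^h,Y^h)=g_1(X^v,Y^v)=\langle X,Y\rangle\circ\pi,\quad g_1(X^h,Y^v)=0,$$ $$\nabla^1_{X^h}Y^h=(\nabla_XY)^h,\quad \nabla^1_{X^h}Y^v=(\nabla_XY)^v,\quad \nabla^1_{X^v}Y^h=\nabla^1_{X^v}Y^v=0 .$$ Iterating this construction from $(M,\nabla,\langle\,,\rangle)$ gives, for every $k\ge1$, the Hermitian manifold $(T^kM,J_k,g_k)$, of complex dimension $n2^{k-1}$.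 For a Hermitian manifold $(N,J,g)$ with $\omega=g(J\cdot,\cdot)$, let $\theta=-d^*\omega\circ J$ be its Lee form. The manifold is balanced if $\theta=0$, locally conformally balanced if $d\theta=0$, and Calabi–Yau with torsion if the Ricci form $\rho^B(X,Y)=\frac12\sum_i g(R^B(X,Y)E_i,JE_i)$ (with $(E_i)$ a local $g$-orthonormal frame) of the Bismut connection, $g(\nabla^B_XY,Z)=g(\nabla^{LC}_XY,Z)+\frac12 d\omega(JX,JY,JZ)$, vanishes. Here $R^B(X,Y)=\nabla^B_{[X,Y]}-\nabla^B_X\nabla^B_Y+\nabla^B_Y\nabla^B_X$. **Theorem.** Let $k_0\ge1$, and assume that $T^{k_0}M$ has complex dimension $n2^{k_0-1}\ge2$. Then $(T^{k_0}M,J_{k_0},g_{k_0})$ is balanced if and only if there are smooth positive functions $f_1,\dots,f_n$ on $\mathbb R^n$ such that, for $j=1,\dots,n$, $$\frac{\partial f_j}{\partial x_j}=0\qquad\text{and}\qquad \mu_j=\frac{(f_1\cdots f_n)^{2^{k_0-1}}}{f_j^{\,n2^{k_0-1}-1}} .$$ In this case $(T^{k_0+1}M,J_{k_0+1},g_{k_0+1})$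 is Calabi–Yau with torsion and, for every $k\ge1$ with $k\ne k_0$, $(T^kM,J_k,g_k)$ is locally conformally balanced. -/

import Mathlib

open scoped ContDiff

/-! ## Tensor calculus in a global chart `ι → ℝ`

Everything below is written in the coordinate frame `∂ᵢ` of the (global) chart `ι → ℝ`.
A metric is a field of Gram matrices `g x i j = ⟨∂ᵢ, ∂ⱼ⟩`, an endomorphism field `J` is a
field of matrices acting by `J ∂ₐ = ∑ c, J c a ∂_c`, and a connection is given by its
coefficients: `Γ x i j l` is the `∂ₗ`-component of `∇_{∂ᵢ} ∂ⱼ` at `x`. -/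

namespace AffineRiemann

noncomputable section

/-- The partial derivative `∂f/∂xᵢ` at `x`. -/
def pd {ι : Type} [Fintype ι] [DecidableEq ι] (i : ι) (f : (ι → ℝ) → ℝ) (x : ι → ℝ) : ℝ :=
  fderiv ℝ f x (Pi.single i 1)

/-- A field of square matrices on the chart `ι → ℝ`. -/
abbrev MatrixField (ι : Type) : Type := (ι → ℝ) → Matrix ι ι ℝ

/-- Coefficients of a connection on the chart `ι → ℝ`. -/
abbrev ConnCoeff (ι : Type) : Type := (ι → ℝ) → ι → ι → ι → ℝ

section Calculus

variable {ι : Type} [Fintype ι] [DecidableEq ι]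

/-- The Levi-Civita connection of `g`:
`Γˡᵢⱼ = ½ ∑ₘ gˡᵐ (∂ᵢ gⱼₘ + ∂ⱼ gᵢₘ - ∂ₘ gᵢⱼ)`. -/
def leviCivita (g : MatrixField ι) : ConnCoeff ι := fun x i j l =>
  (1 / 2 : ℝ) * ∑ m, (g x)⁻¹ l m *
    (pd i (fun y => g y j m) x + pd j (fun y => g y i m) x - pd m (fun y => g y i j) x)

/-- The fundamental form `ω(U, V) = g(JU, V)`. -/
def fundamentalForm (J g : MatrixField ι) : MatrixField ι := fun x =>
  Matrix.of fun a b => ∑ c, J x c a * g x c b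

/-- The components `(dη)(∂ₐ, ∂_b, ∂_c)` of the exterior derivative of a 2-form. -/
def extDerivTwo (η : MatrixField ι) (x : ι → ℝ) (a b c : ι) : ℝ :=
  pd a (fun y => η y b c) x - pd b (fun y => η y a c) x + pd c (fun y => η y a b) x

/-- The components `(∇_{∂ₐ} η)(∂_b, ∂_c)` of the covariant derivative of a 2-form. -/
def covDerivTwo (Γ : ConnCoeff ι) (η : MatrixField ι) (x : ι → ℝ) (a b c : ι) : ℝ :=
  pd a (fun y => η y b c) x - ∑ l, Γ x a b l * η x l c - ∑ l, Γ x a c l * η x b l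

/-- The codifferential `(d*η)(V) = - ∑ᵢ (∇^{LC}_{Eᵢ} η)(Eᵢ, V)` of a 2-form. The sum over a
`g`-orthonormal frame is the metric trace `∑ gᵃᵇ (∇^{LC}_{∂ₐ} η)(∂_b, V)`. -/
def codiffTwo (g η : MatrixField ι) (x : ι → ℝ) (c : ι) : ℝ :=
  - ∑ a, ∑ b, (g x)⁻¹ a b * covDerivTwo (leviCivita g) η x a b c

/-- The Lee form `θ = - d*ω ∘ J`. -/
def leeForm (J g : MatrixField ι) (x : ι → ℝ) (c : ι) : ℝ :=
  - ∑ d, J x d c * codiffTwo g (fundamentalForm J g) x d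

/-- Balanced: the Lee form vanishes. -/
def IsBalanced (J g : MatrixField ι) : Prop := ∀ x c, leeForm J g x c = 0

/-- Locally conformally balanced: the Lee form is closed. -/
def IsLocConfBalanced (J g : MatrixField ι) : Prop :=
  ∀ x a b, pd a (fun y => leeForm J g y b) x - pd b (fun y => leeForm J g y a) x = 0

/-- The Bismut connection:
`g(∇ᴮ_U V, W) = g(∇^{LC}_U V, W) + ½ dω(JU, JV, JW)`. -/
def bismut (J g : MatrixField ι) : ConnCoeff ι := fun x a b l =>
  leviCivita g x a b l + (1 / 2 : ℝ) * ∑ c, (g x)⁻¹ l c *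
    ∑ a', ∑ b', ∑ c', J x a' a * J x b' b * J x c' c *
      extDerivTwo (fundamentalForm J g) x a' b' c'

/-- The curvature `R(U, V) = ∇_{[U,V]} - ∇_U ∇_V + ∇_V ∇_U`: `curvature Γ x a b c l` is the
`∂ₗ`-component of `R(∂ₐ, ∂_b) ∂_c`. -/
def curvature (Γ : ConnCoeff ι) (x : ι → ℝ) (a b c l : ι) : ℝ :=
  - (pd a (fun y => Γ y b c l) x + ∑ m, Γ x b c m * Γ x a m l)
    + (pd b (fun y => Γ y a c l) x + ∑ m, Γ x a c m * Γ x b m l)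

/-- The Ricci form `ρ(U, V) = ½ ∑ᵢ g(R(U, V) Eᵢ, J Eᵢ)` of a connection, the sum over a
`g`-orthonormal frame being the metric trace. -/
def ricciForm (J g : MatrixField ι) (Γ : ConnCoeff ι) (x : ι → ℝ) (a b : ι) : ℝ :=
  (1 / 2 : ℝ) * ∑ c, ∑ d, (g x)⁻¹ c d *
    ∑ l, ∑ m, curvature Γ x a b c l * g x l m * J x m d

/-- Calabi-Yau with torsion: the Ricci form of the Bismut connection vanishes. -/
def IsCalabiYauTorsion (J g : MatrixField ι) : Prop :=
  ∀ x a b, ricciForm J g (bismut J g) x a b = 0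

end Calculus

/-! ## The tangent bundle of an affine-Riemann manifold -/

/-- A connection `∇` and a metric on the manifold `ι → ℝ`. -/
structure Data (ι : Type) where
  conn : ConnCoeff ι
  metric : MatrixField ι

namespace Data

variable {ι : Type} [Fintype ι] [DecidableEq ι]

/-- The base point `x` of a tangent vector. The tangent bundle has the coordinates
`(x, u)`, indexed by `ι ⊕ ι`. -/
def base (p : ι ⊕ ι → ℝ) : ι → ℝ := fun i => p (Sum.inl i)

/-- The matrix `(l, i) ↦ ∑ⱼ Γˡᵢⱼ(x) uⱼ`, so that the connection map of `∇` is
`Q(b, Z) = Z + (connMatrix b)`. -/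
def connMatrix (A : Data ι) (p : ι ⊕ ι → ℝ) : Matrix ι ι ℝ :=
  Matrix.of fun l i => ∑ j, A.conn (base p) i j l * p (Sum.inr j)

/-- The adapted frame of the tangent bundle. Its columns are the horizontal lifts
`∂ᵢʰ = ∂_{xᵢ} - ∑ Γˡᵢⱼ uⱼ ∂_{uₗ}` (kernel of `Q`) and the vertical lifts `∂ᵢᵛ = ∂_{uᵢ}`. -/
def frame (A : Data ι) : MatrixField (ι ⊕ ι) := fun p =>
  Matrix.fromBlocks 1 0 (-(A.connMatrix p)) 1

/-- The dual coframe: a vector has horizontal part `b` and vertical part `Q(b, Z)`. -/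
def coframe (A : Data ι) : MatrixField (ι ⊕ ι) := fun p =>
  Matrix.fromBlocks 1 0 (A.connMatrix p) 1

theorem frame_mul_coframe (A : Data ι) (p : ι ⊕ ι → ℝ) : A.frame p * A.coframe p = 1 := by
  simp [frame, coframe, Matrix.fromBlocks_multiply]

/-- The complex structure of the tangent bundle: `J Xʰ = Xᵛ`, `J Xᵛ = -Xʰ`. -/
def tangentJ (A : Data ι) : MatrixField (ι ⊕ ι) := fun p =>
  A.frame p * Matrix.fromBlocks 0 (-1) 1 0 * A.coframe p

/-- The metric of the tangent bundle: `g(Xʰ, Yʰ) = g(Xᵛ, Yᵛ) = ⟨X, Y⟩`, `g(Xʰ, Yᵛ) = 0`. -/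
def tangentMetric (A : Data ι) : MatrixField (ι ⊕ ι) := fun p =>
  (A.coframe p).transpose *
    Matrix.fromBlocks (A.metric (base p)) 0 0 (A.metric (base p)) * A.coframe p

/-- The tangent-bundle connection in the adapted frame:
`∇_{Xʰ} Yʰ = (∇_X Y)ʰ`, `∇_{Xʰ} Yᵛ = (∇_X Y)ᵛ`, `∇_{Xᵛ} Yʰ = ∇_{Xᵛ} Yᵛ = 0`. -/
def frameConn (A : Data ι) (p : ι ⊕ ι → ℝ) : ι ⊕ ι → ι ⊕ ι → ι ⊕ ι → ℝ
  | Sum.inl i, Sum.inl j, Sum.inl l => A.conn (base p) i j l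
  | Sum.inl i, Sum.inr j, Sum.inr l => A.conn (base p) i j l
  | _, _, _ => 0

/-- The coefficients of the tangent-bundle connection in the coordinate frame, obtained from
`∂_b = ∑ coframe β b e_β` and the Leibniz rule. -/
def tangentConn (A : Data ι) : ConnCoeff (ι ⊕ ι) := fun p a b c =>
  ∑ β, (pd a (fun q => A.coframe q β b) p +
      ∑ α, ∑ δ, A.coframe p α a * A.coframe p δ b * A.frameConn p α δ β) * A.frame p c β

/-- The tangent bundle with its connection and metric. -/
def tangent (A : Data ι) : Data (ι ⊕ ι) where
  conn := A.tangentConn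
  metric := A.tangentMetric

end Data

/-- Index set of the coordinates of the `k`-th iterated tangent bundle. -/
def Idx (ι : Type) : ℕ → Type
  | 0 => ι
  | k + 1 => Idx ι k ⊕ Idx ι k

instance Idx.instFintype (ι : Type) [Fintype ι] : (k : ℕ) → Fintype (Idx ι k)
  | 0 => inferInstanceAs (Fintype ι)
  | k + 1 =>
    letI := Idx.instFintype ι k
    inferInstanceAs (Fintype (Idx ι k ⊕ Idx ι k))

instance Idx.instDecidableEq (ι : Type) [DecidableEq ι] : (k : ℕ) → DecidableEq (Idx ι k)
  | 0 => inferInstanceAs (DecidableEq ι)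
  | k + 1 =>
    letI := Idx.instDecidableEq ι k
    inferInstanceAs (DecidableEq (Idx ι k ⊕ Idx ι k))

/-- The `k`-th iterated tangent bundle `TᵏM` (with `T⁰M = M`), with `∇ᵏ` and `gₖ`. -/
def Data.iter {ι : Type} [Fintype ι] [DecidableEq ι] (A : Data ι) : (k : ℕ) → Data (Idx ι k)
  | 0 => A
  | k + 1 => (A.iter k).tangent

/-- `ℝⁿ` with its canonical affine structure and the metric `Diag(μ₁, …, μₙ)`. -/
def diagData {n : ℕ} (μ : Fin n → (Fin n → ℝ) → ℝ) : Data (Fin n) where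
  conn := fun _ _ _ _ => 0
  metric := fun x => Matrix.diagonal fun j => μ j x

/-! For `k ≥ 1`, the Hermitian manifold `(TᵏM, Jₖ, gₖ)` is the tangent bundle of `Tᵏ⁻¹M` with
the structure induced by `∇ᵏ⁻¹` and `gₖ₋₁`. The predicates below are only used for `k ≥ 1`. -/

section Levels

variable {ι : Type} [Fintype ι] [DecidableEq ι]

/-- `Jₖ`, the complex structure of `TᵏM`, for `k ≥ 1`. -/
def levelJ (A : Data ι) (k : ℕ) : MatrixField (Idx ι (k - 1) ⊕ Idx ι (k - 1)) :=
  (A.iter (k - 1)).tangentJ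

/-- `gₖ`, the metric of `TᵏM`, for `k ≥ 1`. -/
def levelMetric (A : Data ι) (k : ℕ) : MatrixField (Idx ι (k - 1) ⊕ Idx ι (k - 1)) :=
  (A.iter (k - 1)).tangentMetric

end Levels

end

end AffineRiemann

/-!
The flat connection of `ℝⁿ` induces the flat coordinate connection on every iterated tangent bundle,
so `TᵏM` is a coordinate space with the constant complex structure `J ∂ₐ = ε(a) ∂_{σ a}` and a
diagonal metric (`levelJ_succ`, `levelMetric_succ`). Each function `μⱼ`, pulled back from
the base, occurs `2ᵏ⁻¹` times among the horizontal directions of `TᵏM` and as often among the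
vertical ones.

For such a diagonal Hermitian metric with entries `mₐ = m_{σ a}`, sums running over the horizontal
coordinates, everything is explicit:

* the Lee form is `θ(∂_c) = ∂_c (∑ₐ log mₐ - log m_c)` (`leeForm_diagonal`);
* the Bismut connection commutes with `J` (`bismut_diagonal_swap`), so the quadratic terms of its
  curvature have no `J`-trace and its Ricci form is `-½ dτ` (`ricciForm_bismut_diagonal`), where
  `τ(∂_b) = ε(b) ∂_{σ b} (∑ₐ log mₐ - 2 log m_b)` (`sum_frameSign_mul_bismut_diagonal`).

On `TᵏM` the Lee form is therefore carried by the base directions, where it equals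
`∂ⱼ (2ᵏ⁻¹ S - log μⱼ)` with `S = ∑ log μᵢ`. Hence `T^{k₀}M` is balanced if and only if
`∂ⱼ log μⱼ = 2^{k₀-1} ∂ⱼ S` for all `j`, that is, `(∏ μᵢ)^{2^{k₀-1}} / μⱼ` is independent of `xⱼ`.
The functions `fⱼ` are the roots of order `n 2^{k₀-1} - 1` of these quotients
(`exists_factorization_iff`). Given the balanced equations, the Lee form of `TᵏM` is
`(2ᵏ⁻¹ - 2^{k₀-1}) dS`, which is closed, and on `T^{k₀+1}M` the form `τ` is built from
`∂ⱼ (2^{k₀} S - 2 log μⱼ) = 0`, so that the Bismut Ricci form vanishes.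
-/

namespace AffineRiemann

/-! ### Partial derivatives -/

section PartialDerivatives

variable {ι : Type} [Fintype ι] [DecidableEq ι]

@[simp] theorem pd_const (i : ι) (c : ℝ) (x : ι → ℝ) :
    pd i (fun _ => c) x = 0 := by
  simp [pd]

theorem pd_const_mul (i : ι) (c : ℝ) (f : (ι → ℝ) → ℝ) (x : ι → ℝ) :
    pd i (fun y => c * f y) x = c * pd i f x := by
  simp only [pd]
  change fderiv ℝ (c • f) x _ = _
  rw [fderiv_const_smul_field]; rfl

theorem contDiff_pd {f : (ι → ℝ) → ℝ} (hf : ContDiff ℝ ∞ f) (i : ι) : ContDiff ℝ ∞ (pd i f) := by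
  unfold pd
  exact (hf.fderiv_right (m := ∞) (by simp)).clm_apply contDiff_const

theorem pd_sum {α : Type} (s : Finset α) {f : α → (ι → ℝ) → ℝ} {x : ι → ℝ}
    (hf : ∀ j ∈ s, DifferentiableAt ℝ (f j) x) (i : ι) :
    pd i (fun y => ∑ j ∈ s, f j y) x = ∑ j ∈ s, pd i (f j) x := by
  simp only [pd]
  rw [fderiv_fun_sum hf, sum_apply]

theorem pd_sub {f g : (ι → ℝ) → ℝ} {x : ι → ℝ}
    (hf : DifferentiableAt ℝ f x) (hg : DifferentiableAt ℝ g x) (i : ι) :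
    pd i (fun y => f y - g y) x = pd i f x - pd i g x := by
  simp [pd, fderiv_fun_sub hf hg]

theorem pd_log {f : (ι → ℝ) → ℝ} {x : ι → ℝ}
    (hf : DifferentiableAt ℝ f x) (hx : f x ≠ 0) (i : ι) :
    pd i (fun y => Real.log (f y)) x = (f x)⁻¹ * pd i f x := by
  simp [pd, fderiv.log hf hx]

theorem pd_exp {f : (ι → ℝ) → ℝ} {x : ι → ℝ}
    (hf : DifferentiableAt ℝ f x) (i : ι) :
    pd i (fun y => Real.exp (f y)) x = Real.exp (f x) * pd i f x := by
  simp [pd, fderiv_exp hf]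

theorem pd_comm {f : (ι → ℝ) → ℝ} (hf : ContDiff ℝ ∞ f) (i j : ι) (x : ι → ℝ) :
    pd i (pd j f) x = pd j (pd i f) x := by
  have hd : DifferentiableAt ℝ (fderiv ℝ f) x :=
    ((hf.fderiv_right (m := ∞) (by simp)).differentiable (by simp)).differentiableAt
  have key : ∀ i j, pd i (pd j f) x = fderiv ℝ (fderiv ℝ f) x (Pi.single i 1) (Pi.single j 1) := by
    intro i j
    unfold pd
    rw [fderiv_clm_apply hd (differentiableAt_const _)]
    simp
  rw [key, key]
  exact ((contDiff_infty.1 hf 2).contDiffAt.isSymmSndFDerivAt (by simp)).eq _ _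

/-- For a function pulled back along a coordinate projection `(ι' → ℝ) → (ι → ℝ)`, the partial
derivatives in the retained coordinates are those of the function itself. -/
theorem pd_comp_coord {ι' : Type} [Fintype ι'] [DecidableEq ι']
    (e : ι → ι') (he : Function.Injective e) {h : (ι → ℝ) → ℝ} (hh : Differentiable ℝ h)
    (p : ι' → ℝ) (j : ι) : pd (e j) (fun q => h fun i => q (e i)) p = pd j h fun i => p (e i) := by
  let L : (ι' → ℝ) →L[ℝ] (ι → ℝ) := ContinuousLinearMap.pi fun i => ContinuousLinearMap.proj (e i)
  have : HasFDerivAt (fun q => h (L q)) ((fderiv ℝ h (L p)).comp L) p :=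
    (hh (L p)).hasFDerivAt.comp p L.hasFDerivAt
  unfold pd
  change fderiv ℝ (fun q => h (L q)) p _ = fderiv ℝ h (L p) _
  rw [this.fderiv, ContinuousLinearMap.comp_apply]
  congr 1
  ext i
  simp [L, Pi.single_apply, he.eq_iff]

end PartialDerivatives

/-- A function pulled back along a coordinate projection is constant in the coordinates that the
projection forgets. -/
theorem pd_comp_coord_of_notMem {ι : Type} [Fintype ι] {ι' : Type} [Fintype ι']
    [DecidableEq ι'] (e : ι → ι') {h : (ι → ℝ) → ℝ} (hh : Differentiable ℝ h)
    (p : ι' → ℝ) {a : ι'} (ha : ∀ j, e j ≠ a) : pd a (fun q => h fun i => q (e i)) p = 0 := by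
  let L : (ι' → ℝ) →L[ℝ] (ι → ℝ) := ContinuousLinearMap.pi fun i => ContinuousLinearMap.proj (e i)
  have : HasFDerivAt (fun q => h (L q)) ((fderiv ℝ h (L p)).comp L) p :=
    (hh (L p)).hasFDerivAt.comp p L.hasFDerivAt
  unfold pd
  change fderiv ℝ (fun q => h (L q)) p _ = _
  rw [this.fderiv, ContinuousLinearMap.comp_apply]
  have : L (Pi.single a 1) = 0 := by
    ext i
    simp [L, ha]
  rw [this, map_zero]

/-! ### Diagonal metrics invariant under the standard complex structure -/

section DiagonalHermitian

variable {κ : Type}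

/-- The sign `ε` with which the standard complex structure acts on the coordinate frame of a
tangent bundle: `J ∂ₐ = ε(a) ∂_{σ a}`, where `σ = Sum.swap` exchanges horizontal and vertical
coordinates. -/
def frameSign : κ ⊕ κ → ℝ := Sum.elim (fun _ => 1) (fun _ => -1)

@[simp] theorem frameSign_swap (a : κ ⊕ κ) :
    frameSign a.swap = -frameSign a := by
  cases a <;> simp [frameSign]

@[simp] theorem frameSign_mul_self (a : κ ⊕ κ) :
    frameSign a * frameSign a = 1 := by
  cases a <;> simp [frameSign]

theorem swap_eq_iff (a b : κ ⊕ κ) : a.swap = b ↔ a = b.swap := by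
  cases a <;> cases b <;> simp

theorem swap_ne_self (a : κ ⊕ κ) : a.swap ≠ a := by
  cases a <;> simp

/-- The quadratic terms of the curvature do not contribute to the Ricci form: when `A` commutes
with the standard complex structure, `tr (J A B) = tr (J B A)`. The hypothesis is the commutation
written in coordinates. -/
theorem sum_frameSign_mul_comp_comm [Fintype κ] (A B : κ ⊕ κ → κ ⊕ κ → ℝ)
    (hA : ∀ b l, A b l.swap = -(frameSign b * frameSign l * A b.swap l)) :
    ∑ c, frameSign c * ∑ k, B c k * A k c.swap =
      ∑ c, frameSign c * ∑ k, A c k * B k c.swap := by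
  simp only [Finset.mul_sum]
  rw [Finset.sum_comm]
  rw [← (Equiv.sumComm κ κ).sum_comp]
  refine Finset.sum_congr rfl fun k _ => Finset.sum_congr rfl fun c _ => ?_
  simp only [Equiv.sumComm_apply, hA, Sum.swap_swap, frameSign_swap]
  linear_combination (frameSign k * B c k.swap * A k c) * frameSign_mul_self c

variable [DecidableEq κ]

/-- The standard complex structure `∂ᵢʰ ↦ ∂ᵢᵛ`, `∂ᵢᵛ ↦ -∂ᵢʰ`. -/
def stdJ : Matrix (κ ⊕ κ) (κ ⊕ κ) ℝ := Matrix.fromBlocks 0 (-1) 1 0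

theorem stdJ_apply (c a : κ ⊕ κ) :
    stdJ c a = if c = a.swap then frameSign a else 0 := by
  cases c <;> cases a <;> simp [stdJ, frameSign, Matrix.one_apply]
  split_ifs <;> simp

variable [Fintype κ]

theorem inv_diagonal_of_pos {ι : Type} [Fintype ι] [DecidableEq ι] (v : ι → ℝ)
    (hv : ∀ i, 0 < v i) : (Matrix.diagonal v)⁻¹ = Matrix.diagonal fun i => (v i)⁻¹ := by
  apply Matrix.inv_eq_right_inv
  rw [Matrix.diagonal_mul_diagonal, ← Matrix.diagonal_one]
  congr 1
  ext i
  exact mul_inv_cancel₀ (hv i).ne'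

theorem pd_diagonal {ι : Type} [Fintype ι] [DecidableEq ι] (m : ι → (ι → ℝ) → ℝ) (i a b : ι)
    (x : ι → ℝ) : pd i (fun y => Matrix.diagonal (fun j => m j y) a b) x =
      if a = b then pd i (m a) x else 0 := by
  by_cases h : a = b
  · subst h; simp only [Matrix.diagonal_apply_eq, if_true]
  · simp [h]

theorem leviCivita_diagonal {ι : Type} [Fintype ι] [DecidableEq ι] (m : ι → (ι → ℝ) → ℝ)
    (hm : ∀ j x, 0 < m j x) (x : ι → ℝ) (i j l : ι) :
    leviCivita (fun y => Matrix.diagonal fun k => m k y) x i j l =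
      1 / 2 * (m l x)⁻¹ * ((if j = l then pd i (m j) x else 0) +
        (if i = l then pd j (m i) x else 0) - if i = j then pd l (m i) x else 0) := by
  unfold leviCivita
  simp only [pd_diagonal]
  rw [inv_diagonal_of_pos _ (fun k => hm k x), Finset.sum_eq_single l]
  · rw [Matrix.diagonal_apply_eq]; ring
  · intro b _ hb
    rw [Matrix.diagonal_apply_ne' _ hb, zero_mul]
  · simp

/-! From here on, `m` is the diagonal of a metric on `κ ⊕ κ → ℝ`. The hypothesis
`∀ a, m a.swap = m a` says that the metric is Hermitian for the standard complex structure. -/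

variable (m : κ ⊕ κ → (κ ⊕ κ → ℝ) → ℝ)

theorem fundamentalForm_diagonal (hs : ∀ a, m a.swap = m a) (x : κ ⊕ κ → ℝ) (a b : κ ⊕ κ) :
    fundamentalForm (fun _ => stdJ) (fun y => Matrix.diagonal fun k => m k y) x a b =
      if b = a.swap then frameSign a * m a x else 0 := by
  simp only [fundamentalForm, Matrix.of_apply, stdJ_apply, ite_mul, zero_mul,
    Finset.sum_ite_eq', Finset.mem_univ, if_true, Matrix.diagonal_apply, hs]
  simp only [eq_comm (a := b), mul_ite, mul_zero]

theorem pd_fundamentalForm_diagonal (hs : ∀ a, m a.swap = m a) (x : κ ⊕ κ → ℝ)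
    (i a b : κ ⊕ κ) :
    pd i (fun y => fundamentalForm (fun _ => stdJ) (fun y => Matrix.diagonal fun k => m k y)
      y a b) x = if b = a.swap then frameSign a * pd i (m a) x else 0 := by
  simp only [fundamentalForm_diagonal m hs]
  split_ifs
  · rw [pd_const_mul]
  · simp

theorem codiffTwo_diagonal (hs : ∀ a, m a.swap = m a) (hm : ∀ j x, 0 < m j x) (x : κ ⊕ κ → ℝ)
    (c : κ ⊕ κ) :
    codiffTwo (fun y => Matrix.diagonal fun k => m k y)
      (fundamentalForm (fun _ => stdJ) (fun y => Matrix.diagonal fun k => m k y)) x c =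
      frameSign c * (1 / 2 * ∑ a, (m a x)⁻¹ * pd c.swap (m a) x
        - (m c x)⁻¹ * pd c.swap (m c) x) := by
  -- The diagonal terms of the metric trace of `∇ω`.
  have hcov : ∀ a, covDerivTwo (leviCivita fun y => Matrix.diagonal fun k => m k y)
      (fundamentalForm (fun _ => stdJ) (fun y => Matrix.diagonal fun k => m k y)) x a a c =
      frameSign c * ((if a = c then 1 / 2 * pd c.swap (m c) x else 0)
        + (if a = c.swap then 1 / 2 * pd c.swap (m c) x else 0)
        - 1 / 2 * pd c.swap (m a) x) := by
    intro a
    unfold covDerivTwo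
    rw [pd_fundamentalForm_diagonal m hs, Finset.sum_eq_single c.swap, Finset.sum_eq_single a.swap]
    · simp only [fundamentalForm_diagonal m hs, leviCivita_diagonal m hm, hs, Sum.swap_swap,
        if_true, frameSign_swap]
      have hc := (hm c x).ne'
      have ha := (hm a x).ne'
      by_cases h1 : a = c.swap
      · subst h1
        simp [hs, swap_ne_self]
        rw [hs] at ha
        field_simp
        ring
      · have h2 : c ≠ a.swap := fun h => h1 (by rw [h, Sum.swap_swap])
        by_cases h3 : a = c
        · subst h3
          simp [(swap_ne_self _).symm]
        · simp [h1, h2, h3, (swap_ne_self _).symm]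
          field_simp
    · intro l _ hl
      rw [fundamentalForm_diagonal m hs, if_neg hl, mul_zero]
    · simp
    · intro l _ hl
      rw [fundamentalForm_diagonal m hs, if_neg (fun h => hl (by rw [h, Sum.swap_swap])), mul_zero]
    · simp
  have hsum : ∀ a, ∑ b, (Matrix.diagonal fun k => m k x)⁻¹ a b *
      covDerivTwo (leviCivita fun y => Matrix.diagonal fun k => m k y)
      (fundamentalForm (fun _ => stdJ) (fun y => Matrix.diagonal fun k => m k y)) x a b c =
      frameSign c * ((if a = c then (m c x)⁻¹ * (1 / 2 * pd c.swap (m c) x) else 0)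
        + (if a = c.swap then (m c x)⁻¹ * (1 / 2 * pd c.swap (m c) x) else 0)
        - 1 / 2 * ((m a x)⁻¹ * pd c.swap (m a) x)) := by
    intro a
    rw [inv_diagonal_of_pos _ (fun k => hm k x), Finset.sum_eq_single a, hcov,
      Matrix.diagonal_apply_eq]
    · by_cases h1 : a = c
      · subst h1; simp only [(swap_ne_self _).symm, if_true, if_false]; ring
      · by_cases h2 : a = c.swap
        · subst h2; simp only [hs, swap_ne_self, if_true, if_false]; ring
        · simp only [h1, h2, if_false]; ring
    · intro b _ hb
      rw [Matrix.diagonal_apply_ne' _ hb, zero_mul]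
    · simp
  unfold codiffTwo
  simp only [hsum]
  rw [← Finset.mul_sum, Finset.sum_sub_distrib, Finset.sum_add_distrib, ← Finset.mul_sum]
  simp only [Finset.sum_ite_eq', Finset.mem_univ, if_true]
  ring

/-- The Lee form is `θ(∂_c) = ∂_c (∑ₐ log mₐ - log m_c)`, the sum running over one of the two
halves of the coordinates. -/
theorem leeForm_diagonal (hs : ∀ a, m a.swap = m a) (hm : ∀ j x, 0 < m j x) (x : κ ⊕ κ → ℝ)
    (c : κ ⊕ κ) :
    leeForm (fun _ => stdJ) (fun y => Matrix.diagonal fun k => m k y) x c =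
      ∑ a : κ, (m (Sum.inl a) x)⁻¹ * pd c (m (Sum.inl a)) x - (m c x)⁻¹ * pd c (m c) x := by
  have hr : ∀ a, m (Sum.inr a) = m (Sum.inl a) := fun a => hs (Sum.inl a)
  unfold leeForm
  rw [Finset.sum_eq_single c.swap]
  · simp only [codiffTwo_diagonal m hs hm, stdJ_apply, if_true, Fintype.sum_sum_type]
    simp only [hr, hs, Sum.swap_swap, frameSign_swap]
    linear_combination (∑ a : κ, (m (Sum.inl a) x)⁻¹ * pd c (m (Sum.inl a)) x -
      (m c x)⁻¹ * pd c (m c) x) * frameSign_mul_self c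
  · intro b _ hb
    simp only [stdJ_apply, if_neg hb, zero_mul]
  · simp

/-! ### The Bismut connection and its Ricci form -/

theorem extDerivTwo_diagonal (hs : ∀ a, m a.swap = m a) (x : κ ⊕ κ → ℝ) (a b c : κ ⊕ κ) :
    extDerivTwo (fundamentalForm (fun _ => stdJ) (fun y => Matrix.diagonal fun k => m k y))
      x a b c = (if c = b.swap then frameSign b * pd a (m b) x else 0) -
        (if c = a.swap then frameSign a * pd b (m a) x else 0) +
        (if b = a.swap then frameSign a * pd c (m a) x else 0) := by
  simp only [extDerivTwo, pd_fundamentalForm_diagonal m hs]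

theorem bismut_diagonal (hs : ∀ a, m a.swap = m a) (hm : ∀ j x, 0 < m j x) (x : κ ⊕ κ → ℝ)
    (a b l : κ ⊕ κ) :
    bismut (fun _ => stdJ) (fun y => Matrix.diagonal fun k => m k y) x a b l =
      1 / 2 * (m l x)⁻¹ * ((if b = l then pd a (m b) x else 0) +
        (if a = l then pd b (m a) x else 0) - (if a = b then pd l (m a) x else 0) +
        frameSign a * frameSign b * (if l = b.swap then pd a.swap (m b) x else 0) +
        frameSign b * frameSign l * (if l = a.swap then pd b.swap (m a) x else 0) -
        frameSign b * frameSign l * (if b = a.swap then pd l.swap (m a) x else 0)) := by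
  unfold bismut
  rw [leviCivita_diagonal m hm, inv_diagonal_of_pos _ (fun k => hm k x), Finset.sum_eq_single l,
    Finset.sum_eq_single a.swap, Finset.sum_eq_single b.swap, Finset.sum_eq_single l.swap,
    extDerivTwo_diagonal m hs]
  · simp only [Matrix.diagonal_apply_eq, stdJ_apply, if_true, swap_eq_iff, Sum.swap_swap, hs,
      frameSign_swap]
    have ha := frameSign_mul_self a
    have hb := frameSign_mul_self b
    -- In each term of `dω(J∂ₐ, J∂_b, J∂_l)` one of the four signs squares away.
    have e1 : ∀ P, frameSign a * frameSign b * frameSign l *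
        (if l = b.swap then -frameSign b * P else 0) =
        frameSign a * frameSign b * if l = b.swap then P else 0 := by
      intro P
      split_ifs with h
      · subst h
        rw [frameSign_swap]
        linear_combination frameSign a * frameSign b * P * hb
      · simp
    have e2 : ∀ (p : Prop) [Decidable p] (P : ℝ),
        frameSign a * frameSign b * frameSign l *
        (if p then -frameSign a * P else 0) =
        -(frameSign b * frameSign l * if p then P else 0) := by
      intro p _ P
      split_ifs with h
      · linear_combination -frameSign b * frameSign l * P * ha
      · simp
    rw [mul_add, mul_sub (frameSign a * _ * _), e1, e2, e2]
    ring
  all_goals simp +contextual [stdJ_apply, eq_comm]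

/-- The Bismut connection preserves the constant complex structure: this is `J Γₐ = Γₐ J` written
in coordinates. -/
theorem bismut_diagonal_swap (hs : ∀ a, m a.swap = m a) (hm : ∀ j x, 0 < m j x)
    (x : κ ⊕ κ → ℝ) (a b l : κ ⊕ κ) :
    bismut (fun _ => stdJ) (fun y => Matrix.diagonal fun k => m k y) x a b l.swap =
      -(frameSign b * frameSign l *
        bismut (fun _ => stdJ) (fun y => Matrix.diagonal fun k => m k y) x a b.swap l) := by
  have ha := frameSign_mul_self a
  have hb := frameSign_mul_self b
  have hl := frameSign_mul_self l
  simp only [bismut_diagonal m hs hm, hs, frameSign_swap, Sum.swap_swap]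
  -- All index conditions are brought to one form, so that both sides have the same six terms.
  have c1 : (b = l.swap) ↔ (l = b.swap) := by rw [← swap_eq_iff]; exact eq_comm
  have c2 : (a = l.swap) ↔ (l = a.swap) := by rw [← swap_eq_iff]; exact eq_comm
  have c3 : (l.swap = b.swap) ↔ (b = l) := by rw [swap_eq_iff, Sum.swap_swap]; exact eq_comm
  have c4 : (l.swap = a.swap) ↔ (a = l) := by rw [swap_eq_iff, Sum.swap_swap]; exact eq_comm
  have c5 : (b.swap = l) ↔ (l = b.swap) := eq_comm
  have c6 : (b.swap = a.swap) ↔ (a = b) := by rw [swap_eq_iff, Sum.swap_swap]; exact eq_comm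
  have c7 : (a = b.swap) ↔ (b = a.swap) := by rw [← swap_eq_iff]; exact eq_comm
  have c8 : (l = b) ↔ (b = l) := eq_comm
  simp only [c1, c2, c3, c4, c5, c6, c7, c8]
  have f1 : frameSign b * frameSign l * (if l = b.swap then pd a (m b) x else 0) =
      -if l = b.swap then pd a (m b) x else 0 := by
    split_ifs with h
    · rw [h, frameSign_swap]
      linear_combination -pd a (m b) x * hb
    · simp
  have f2 : frameSign l * (if b = l then pd a.swap (m b) x else 0) =
      frameSign b * if b = l then pd a.swap (m b) x else 0 := by
    split_ifs with h
    · rw [h]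
    · simp
  linear_combination 1 / 2 * (m l x)⁻¹ * (f1 - frameSign a * f2
    - ((if l = a.swap then pd b (m a) x else 0) - (if a = b then pd l.swap (m a) x else 0))
      * (frameSign l * frameSign l * hb + hl)
    - frameSign a * frameSign l * (if b = l then pd a.swap (m b) x else 0) * hb)

/-- The `J`-trace `τ(∂_b) = ∑ c, ε(c) Γ_{bc}^{σ c}` of the Bismut connection:
`τ(∂_b) = ε(b) ∂_{σ b} (∑ₐ log mₐ - 2 log m_b)`. -/
theorem sum_frameSign_mul_bismut_diagonal (hs : ∀ a, m a.swap = m a)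
    (hm : ∀ j x, 0 < m j x) (x : κ ⊕ κ → ℝ) (b : κ ⊕ κ) :
    ∑ c, frameSign c *
      bismut (fun _ => stdJ) (fun y => Matrix.diagonal fun k => m k y) x b c c.swap =
    frameSign b * (∑ a : κ, (m (Sum.inl a) x)⁻¹ * pd b.swap (m (Sum.inl a)) x
      - 2 * ((m b x)⁻¹ * pd b.swap (m b) x)) := by
  have hr : ∀ a, m (Sum.inr a) = m (Sum.inl a) := fun a => hs (Sum.inl a)
  have key : ∀ c, frameSign c *
      bismut (fun _ => stdJ) (fun y => Matrix.diagonal fun k => m k y) x b c c.swap =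
      1 / 2 * frameSign b * ((m c x)⁻¹ * pd b.swap (m c) x)
        - (if c = b then frameSign b * ((m b x)⁻¹ * pd b.swap (m b) x) else 0)
        - (if c = b.swap then frameSign b * ((m b x)⁻¹ * pd b.swap (m b) x) else 0) := by
    intro c
    have hc := frameSign_mul_self c
    have c1 : (b = c.swap) ↔ (c = b.swap) := by rw [← swap_eq_iff]; exact eq_comm
    have c2 : (c.swap = b.swap) ↔ (c = b) := by rw [swap_eq_iff, Sum.swap_swap]
    have c3 : (b = c) ↔ (c = b) := eq_comm
    simp only [bismut_diagonal m hs hm, hs, frameSign_swap, Sum.swap_swap, c1, c2, c3,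
      (swap_ne_self c).symm, if_true, if_false]
    by_cases h1 : c = b
    · subst h1
      simp only [(swap_ne_self c).symm, if_true, if_false]
      ring
    · by_cases h2 : c = b.swap
      · subst h2
        simp only [swap_ne_self, if_true, if_false, hs, frameSign_swap]
        ring
      · simp only [h1, h2, if_false]
        linear_combination (m c x)⁻¹ * frameSign b * pd b.swap (m c) x / 2 * hc
  simp only [key]
  rw [Finset.sum_sub_distrib, Finset.sum_sub_distrib, ← Finset.mul_sum]
  simp only [Finset.sum_ite_eq', Finset.mem_univ, if_true, Fintype.sum_sum_type, hr]
  ring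

/-- As the Gram entries in the directions `c` and `σ c` agree, the metric drops out of the Ricci
form. What remains is half of `∑ c, ε(c) R_c^{σ c}`, which is, up to sign, the trace of `J R`. -/
theorem ricciForm_diagonal (hs : ∀ a, m a.swap = m a)
    (hm : ∀ j x, 0 < m j x) (Γ : ConnCoeff (κ ⊕ κ)) (x : κ ⊕ κ → ℝ) (a b : κ ⊕ κ) :
    ricciForm (fun _ => stdJ) (fun y => Matrix.diagonal fun k => m k y) Γ x a b =
      1 / 2 * ∑ c, frameSign c * curvature Γ x a b c c.swap := by
  unfold ricciForm
  congr 1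
  refine Finset.sum_congr rfl fun c _ => ?_
  rw [inv_diagonal_of_pos _ (fun k => hm k x), Finset.sum_eq_single c,
    Finset.sum_eq_single c.swap, Finset.sum_eq_single c.swap]
  · have := (hm c x).ne'
    simp only [stdJ_apply, Matrix.diagonal_apply_eq, hs, if_true]
    field_simp
  all_goals simp +contextual [stdJ_apply, Matrix.diagonal_apply, eq_comm]

theorem contDiff_bismut_diagonal (hs : ∀ a, m a.swap = m a) (hm : ∀ j x, 0 < m j x)
    (hc : ∀ j, ContDiff ℝ ∞ (m j)) (a b l : κ ⊕ κ) :
    ContDiff ℝ ∞ fun x =>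
      bismut (fun _ => stdJ) (fun y => Matrix.diagonal fun k => m k y) x a b l := by
  simp only [bismut_diagonal m hs hm]
  have h0 : ∀ (p : Prop) [Decidable p] (i j : κ ⊕ κ),
      ContDiff ℝ ∞ fun x => if p then pd i (m j) x else 0 := by
    intro p _ i j
    split_ifs
    · exact contDiff_pd (hc j) i
    · exact contDiff_const
  refine ContDiff.mul (contDiff_const.mul ((hc l).inv fun x => (hm l x).ne')) ?_
  exact ((((((h0 _ _ _).add (h0 _ _ _)).sub (h0 _ _ _)).add (contDiff_const.mul (h0 _ _ _))).add
    (contDiff_const.mul (h0 _ _ _))).sub (contDiff_const.mul (h0 _ _ _)))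

/-- The Bismut Ricci form is `-½ dτ` for the 1-form `τ(∂_b) = ∑ c, ε(c) Γ_{bc}^{σ c}`, since the
quadratic part of the curvature has vanishing `J`-trace. -/
theorem ricciForm_bismut_diagonal (hs : ∀ a, m a.swap = m a) (hm : ∀ j x, 0 < m j x)
    (hc : ∀ j, ContDiff ℝ ∞ (m j)) (x : κ ⊕ κ → ℝ) (a b : κ ⊕ κ) :
    ricciForm (fun _ => stdJ) (fun y => Matrix.diagonal fun k => m k y)
      (bismut (fun _ => stdJ) (fun y => Matrix.diagonal fun k => m k y)) x a b =
    1 / 2 * (pd b (fun y => ∑ c, frameSign c *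
        bismut (fun _ => stdJ) (fun y => Matrix.diagonal fun k => m k y) y a c c.swap) x -
      pd a (fun y => ∑ c, frameSign c *
        bismut (fun _ => stdJ) (fun y => Matrix.diagonal fun k => m k y) y b c c.swap) x) := by
  have hd : ∀ a b l, DifferentiableAt ℝ (fun y =>
      bismut (fun _ => stdJ) (fun y => Matrix.diagonal fun k => m k y) y a b l) x := fun a b l =>
    ((contDiff_bismut_diagonal m hs hm hc a b l).differentiable (by simp)).differentiableAt
  have hcomm := sum_frameSign_mul_comp_comm
    (bismut (fun _ => stdJ) (fun y => Matrix.diagonal fun k => m k y) x a)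
    (bismut (fun _ => stdJ) (fun y => Matrix.diagonal fun k => m k y) x b)
    (bismut_diagonal_swap m hs hm x a)
  rw [ricciForm_diagonal m hs hm, pd_sum _ fun c _ => (hd a c c.swap).const_mul _,
    pd_sum _ fun c _ => (hd b c c.swap).const_mul _]
  simp only [curvature, pd_const_mul, mul_add, mul_neg, Finset.sum_add_distrib,
    Finset.sum_neg_distrib, hcomm]
  ring

end DiagonalHermitian

/-! ### The iterated tangent bundles -/

section Iteration

namespace Data

variable {ι : Type} [Fintype ι]

theorem connMatrix_eq_zero {A : Data ι} (h : ∀ x i j l, A.conn x i j l = 0) (p : ι ⊕ ι → ℝ) :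
    A.connMatrix p = 0 := by
  ext l i
  simp [connMatrix, h]

variable [DecidableEq ι]

theorem coframe_eq_one {A : Data ι} (h : ∀ x i j l, A.conn x i j l = 0) (p : ι ⊕ ι → ℝ) :
    A.coframe p = 1 := by
  simp [coframe, connMatrix_eq_zero h]

theorem frame_eq_one {A : Data ι} (h : ∀ x i j l, A.conn x i j l = 0) (p : ι ⊕ ι → ℝ) :
    A.frame p = 1 := by
  simp [frame, connMatrix_eq_zero h]

theorem tangentJ_eq_stdJ {A : Data ι} (h : ∀ x i j l, A.conn x i j l = 0) :
    A.tangentJ = fun _ => stdJ := by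
  ext1 p
  simp [tangentJ, frame_eq_one h, coframe_eq_one h, stdJ]

theorem tangentConn_eq_zero {A : Data ι} (h : ∀ x i j l, A.conn x i j l = 0)
    (p : ι ⊕ ι → ℝ) (a b c : ι ⊕ ι) : A.tangentConn p a b c = 0 := by
  have hf : ∀ α δ β, A.frameConn p α δ β = 0 := by
    intro α δ β
    cases α <;> cases δ <;> cases β <;> simp [frameConn, h]
  simp [tangentConn, coframe_eq_one h, hf]

theorem tangentMetric_eq_diagonal {A : Data ι} (h : ∀ x i j l, A.conn x i j l = 0)
    {d : ι → (ι → ℝ) → ℝ} (hd : A.metric = fun x => Matrix.diagonal fun j => d j x) :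
    A.tangentMetric = fun p => Matrix.diagonal fun a => d (Sum.elim id id a) (base p) := by
  ext1 p
  simp only [tangentMetric, coframe_eq_one h, hd, Matrix.transpose_one, Matrix.one_mul,
    Matrix.mul_one, Matrix.fromBlocks_diagonal]
  congr 1
  ext a
  cases a <;> rfl

end Data

/-- A coordinate of the `k`-th iterated tangent bundle descends from a coordinate of the base, to
which it is sent. -/
def Idx.root {ι : Type} : (k : ℕ) → Idx ι k → ι
  | 0 => fun i => i
  | k + 1 => fun a => Sum.elim (Idx.root k) (Idx.root k) a

/-- The coordinates of the base among those of its `k`-th iterated tangent bundle: restricting a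
point to them is the projection to the base. -/
def Idx.baseIdx {ι : Type} : (k : ℕ) → ι → Idx ι k
  | 0 => fun i => i
  | k + 1 => fun i => Sum.inl (Idx.baseIdx k i)

theorem Idx.root_baseIdx {ι : Type} (k : ℕ) (i : ι) :
    Idx.root k (Idx.baseIdx k i) = i := by
  induction k with
  | zero => rfl
  | succ k ih => exact ih

theorem Idx.baseIdx_injective {ι : Type} (k : ℕ) :
    Function.Injective (Idx.baseIdx (ι := ι) k) :=
  Function.LeftInverse.injective (Idx.root_baseIdx k)

/-- Every coordinate of the base has `2ᵏ` descendants. -/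
theorem Idx.sum_root {ι : Type} [Fintype ι] (k : ℕ) (F : ι → ℝ) :
    ∑ a : Idx ι k, F (Idx.root k a) = 2 ^ k * ∑ i, F i := by
  induction k with
  | zero => simp; rfl
  | succ k ih =>
    have : ∑ a : Idx ι (k + 1), F (Idx.root (k + 1) a) =
        ∑ a : Idx ι k ⊕ Idx ι k, F (Sum.elim (Idx.root k) (Idx.root k) a) := rfl
    rw [this, Fintype.sum_sum_type]
    simp only [Sum.elim_inl, Sum.elim_inr, ih]
    ring

variable {n : ℕ} (μ : Fin n → (Fin n → ℝ) → ℝ)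

theorem conn_iter_diagData (k : ℕ) (x i j l) : ((diagData μ).iter k).conn x i j l = 0 := by
  induction k with
  | zero => rfl
  | succ k ih => exact Data.tangentConn_eq_zero ih x i j l

theorem metric_iter_diagData (k : ℕ) : ((diagData μ).iter k).metric =
    fun p => Matrix.diagonal fun a => μ (Idx.root k a) fun i => p (Idx.baseIdx k i) := by
  induction k with
  | zero => rfl
  | succ k ih =>
    refine (Data.tangentMetric_eq_diagonal (conn_iter_diagData μ k) ih).trans ?_
    ext1 p
    exact congrArg Matrix.diagonal (funext fun a => by cases a <;> rfl)

/-- The diagonal entry of the metric of `Tᵏ⁺¹M` at the coordinate `a`. It is the pullback of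
`μⱼ`, where `j` is the base coordinate that `a` descends from. -/
def levelWeight (k : ℕ) (a : Idx (Fin n) k ⊕ Idx (Fin n) k)
    (p : Idx (Fin n) k ⊕ Idx (Fin n) k → ℝ) : ℝ :=
  μ (Sum.elim (Idx.root k) (Idx.root k) a) fun i => p (Sum.inl (Idx.baseIdx k i))

theorem levelJ_succ (k : ℕ) : levelJ (diagData μ) (k + 1) = fun _ => stdJ :=
  Data.tangentJ_eq_stdJ (conn_iter_diagData μ k)

theorem levelMetric_succ (k : ℕ) : levelMetric (diagData μ) (k + 1) =
    fun p => Matrix.diagonal fun a => levelWeight μ k a p := by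
  refine (Data.tangentMetric_eq_diagonal (conn_iter_diagData μ k)
    (metric_iter_diagData μ k)).trans ?_
  ext1 p
  congr 1
  ext a
  cases a <;> rfl

end Iteration

/-! ### The balanced, locally conformally balanced and Calabi-Yau conditions -/

section Levels

variable {n : ℕ} {μ : Fin n → (Fin n → ℝ) → ℝ}

theorem levelWeight_swap (k : ℕ) (a) : levelWeight μ k a.swap = levelWeight μ k a := by
  cases a <;> rfl

theorem contDiff_levelWeight (hμ : ∀ j, ContDiff ℝ ∞ (μ j)) (k : ℕ) (a) :
    ContDiff ℝ ∞ (levelWeight μ k a) := by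
  unfold levelWeight
  exact (hμ _).comp (contDiff_pi.2 fun i => contDiff_apply ℝ ℝ _)

/-- The logarithm `∑ log μᵢ` of the determinant of the metric `Diag(μ₁, …, μₙ)`. -/
noncomputable def logVolume (μ : Fin n → (Fin n → ℝ) → ℝ) (x : Fin n → ℝ) : ℝ :=
  ∑ i, Real.log (μ i x)

theorem contDiff_log (hμ : ∀ j, ContDiff ℝ ∞ (μ j)) (hpos : ∀ j x, 0 < μ j x) (j : Fin n) :
    ContDiff ℝ ∞ fun x => Real.log (μ j x) :=
  (hμ j).log fun x => (hpos j x).ne'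

theorem contDiff_logVolume (hμ : ∀ j, ContDiff ℝ ∞ (μ j)) (hpos : ∀ j x, 0 < μ j x) :
    ContDiff ℝ ∞ (logVolume μ) :=
  ContDiff.sum fun j _ => contDiff_log hμ hpos j

theorem pd_logVolume (hμ : ∀ j, ContDiff ℝ ∞ (μ j)) (hpos : ∀ j x, 0 < μ j x) (j : Fin n)
    (x : Fin n → ℝ) : pd j (logVolume μ) x = ∑ i, pd j (fun y => Real.log (μ i y)) x := by
  unfold logVolume
  exact pd_sum _ (fun i _ =>
    ((contDiff_log hμ hpos i).differentiable (by simp)).differentiableAt) _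

/-- The logarithmic derivative of a diagonal entry in a base direction. -/
theorem logDeriv_levelWeight (hμ : ∀ j, ContDiff ℝ ∞ (μ j)) (hpos : ∀ j x, 0 < μ j x) (k : ℕ)
    (a) (p) (j : Fin n) :
    (levelWeight μ k a p)⁻¹ * pd (Sum.inl (Idx.baseIdx k j)) (levelWeight μ k a) p =
      pd j (fun y => Real.log (μ (Sum.elim (Idx.root k) (Idx.root k) a) y))
        fun i => p (Sum.inl (Idx.baseIdx k i)) := by
  have hd : ∀ i, Differentiable ℝ (μ i) := fun i => (hμ i).differentiable (by simp)
  rw [pd_log (hd _).differentiableAt (hpos _ _).ne']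
  unfold levelWeight
  rw [pd_comp_coord (fun i => (Sum.inl (Idx.baseIdx k i) : Idx (Fin n) k ⊕ Idx (Fin n) k))
    (Sum.inl_injective.comp (Idx.baseIdx_injective k)) (hd _)]

theorem pd_levelWeight_of_notMem (hμ : ∀ j, ContDiff ℝ ∞ (μ j)) (k : ℕ)
    (a) (p) {c : Idx (Fin n) k ⊕ Idx (Fin n) k}
    (hc : ∀ j, Sum.inl (Idx.baseIdx k j) ≠ c) : pd c (levelWeight μ k a) p = 0 := by
  unfold levelWeight
  exact pd_comp_coord_of_notMem
    (fun i => (Sum.inl (Idx.baseIdx k i) : Idx (Fin n) k ⊕ Idx (Fin n) k))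
    ((hμ _).differentiable (by simp)) p hc

theorem sum_logDeriv_levelWeight (hμ : ∀ j, ContDiff ℝ ∞ (μ j)) (hpos : ∀ j x, 0 < μ j x)
    (k : ℕ) (p) (j : Fin n) :
    ∑ a, (levelWeight μ k (Sum.inl a) p)⁻¹ *
      pd (Sum.inl (Idx.baseIdx k j)) (levelWeight μ k (Sum.inl a)) p =
      2 ^ k * pd j (logVolume μ) fun i => p (Sum.inl (Idx.baseIdx k i)) := by
  simp only [logDeriv_levelWeight hμ hpos, Sum.elim_inl, pd_logVolume hμ hpos]
  exact Idx.sum_root k fun r => pd j (fun y => Real.log (μ r y))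
    fun i => p (Sum.inl (Idx.baseIdx k i))

/-- In a base direction the Lee form of `Tᵏ⁺¹M` is `∂ⱼ (2ᵏ ∑ log μᵢ - log μⱼ)`; in the other
coordinate directions it vanishes, as in `leeForm_level_of_notMem`. -/
theorem leeForm_level_baseIdx (hμ : ∀ j, ContDiff ℝ ∞ (μ j)) (hpos : ∀ j x, 0 < μ j x)
    (k : ℕ) (p) (j : Fin n) :
    leeForm (levelJ (diagData μ) (k + 1)) (levelMetric (diagData μ) (k + 1)) p
      (Sum.inl (Idx.baseIdx k j)) =
      2 ^ k * pd j (logVolume μ) (fun i => p (Sum.inl (Idx.baseIdx k i))) -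
      pd j (fun y => Real.log (μ j y)) fun i => p (Sum.inl (Idx.baseIdx k i)) := by
  rw [levelJ_succ, levelMetric_succ]
  refine (leeForm_diagonal _ (levelWeight_swap k) (fun a x => hpos _ _) p _).trans ?_
  rw [← sum_logDeriv_levelWeight hμ hpos, logDeriv_levelWeight hμ hpos k (Sum.inl _), Sum.elim_inl,
    Idx.root_baseIdx]

theorem leeForm_level_of_notMem (hμ : ∀ j, ContDiff ℝ ∞ (μ j)) (hpos : ∀ j x, 0 < μ j x)
    (k : ℕ) (p) {c : Idx (Fin n) k ⊕ Idx (Fin n) k}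
    (hc : ∀ j, Sum.inl (Idx.baseIdx k j) ≠ c) :
    leeForm (levelJ (diagData μ) (k + 1)) (levelMetric (diagData μ) (k + 1)) p c = 0 := by
  rw [levelJ_succ, levelMetric_succ]
  refine (leeForm_diagonal _ (levelWeight_swap k) (fun a x => hpos _ _) p _).trans ?_
  have : ∀ a, pd c (levelWeight μ k a) p = 0 := fun a => pd_levelWeight_of_notMem hμ k a p hc
  exact (by simp [this] : ∑ a, (levelWeight μ k (Sum.inl a) p)⁻¹ *
    pd c (levelWeight μ k (Sum.inl a)) p - _ * pd c (levelWeight μ k c) p = 0)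

theorem isBalanced_level_iff (hμ : ∀ j, ContDiff ℝ ∞ (μ j)) (hpos : ∀ j x, 0 < μ j x) (k : ℕ) :
    IsBalanced (levelJ (diagData μ) (k + 1)) (levelMetric (diagData μ) (k + 1)) ↔
      ∀ j x, pd j (fun y => Real.log (μ j y)) x = 2 ^ k * pd j (logVolume μ) x := by
  constructor
  · intro h j x
    -- A point `x` of the base is lifted to the point all of whose coordinates repeat those of `x`.
    have hx : (fun i => Sum.elim (fun a => x (Idx.root k a)) (fun a => x (Idx.root k a))
        (Sum.inl (Idx.baseIdx k i) : Idx (Fin n) k ⊕ Idx (Fin n) k)) = x := by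
      ext i
      rw [Sum.elim_inl, Idx.root_baseIdx]
    have := h (Sum.elim (fun a => x (Idx.root k a)) (fun a => x (Idx.root k a)))
      (Sum.inl (Idx.baseIdx k j))
    rw [leeForm_level_baseIdx hμ hpos] at this
    erw [hx] at this
    linarith
  · intro h p c
    by_cases hc : ∃ j, Sum.inl (Idx.baseIdx k j) = c
    · obtain ⟨j, rfl⟩ := hc
      exact (leeForm_level_baseIdx hμ hpos k p j).trans (by rw [h]; ring)
    · exact leeForm_level_of_notMem hμ hpos k p (not_exists.1 hc)

/-- If `∂ⱼ log μⱼ` is a fixed multiple `N` of `∂ⱼ ∑ log μᵢ`, then the Lee form of `Tᵏ⁺¹M` is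
`(2ᵏ - N)` times the differential of the pullback of `∑ log μᵢ`, hence closed. -/
theorem isLocConfBalanced_level (hμ : ∀ j, ContDiff ℝ ∞ (μ j)) (hpos : ∀ j x, 0 < μ j x)
    {N : ℝ} (h : ∀ j x, pd j (fun y => Real.log (μ j y)) x = N * pd j (logVolume μ) x) (k : ℕ) :
    IsLocConfBalanced (levelJ (diagData μ) (k + 1)) (levelMetric (diagData μ) (k + 1)) := by
  have hS : ContDiff ℝ ∞ (logVolume μ) := contDiff_logVolume hμ hpos
  let e : Fin n → Idx (Fin n) k ⊕ Idx (Fin n) k := fun i => Sum.inl (Idx.baseIdx k i)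
  have he : Function.Injective e := Sum.inl_injective.comp (Idx.baseIdx_injective k)
  let F : (Idx (Fin n) k ⊕ Idx (Fin n) k → ℝ) → ℝ := fun p => logVolume μ fun i => p (e i)
  have hF : ContDiff ℝ ∞ F := hS.comp (contDiff_pi.2 fun i => contDiff_apply ℝ ℝ _)
  have key : ∀ c, (fun p => leeForm (levelJ (diagData μ) (k + 1))
      (levelMetric (diagData μ) (k + 1)) p c) = fun p => (2 ^ k - N) * pd c F p := by
    intro c
    ext p
    by_cases hc : ∃ j, e j = c
    · obtain ⟨j, rfl⟩ := hc
      rw [pd_comp_coord e he (hS.differentiable (by simp))]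
      exact (leeForm_level_baseIdx hμ hpos k p j).trans (by rw [h]; ring)
    · rw [pd_comp_coord_of_notMem e (hS.differentiable (by simp)) p (not_exists.1 hc), mul_zero]
      exact leeForm_level_of_notMem hμ hpos k p (not_exists.1 hc)
  intro p a b
  rw [key, key, pd_const_mul, pd_const_mul, pd_comm hF, sub_self]

/-- Passing from `Tᵏ⁺¹M` to `Tᵏ⁺²M` doubles the sum over the coordinates, so that the `J`-trace
`∂ⱼ (2ᵏ⁺¹ ∑ log μᵢ - 2 log μⱼ)` of the Bismut connection of `Tᵏ⁺²M` is twice the Lee form of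
`Tᵏ⁺¹M`, up to sign and complex structure. It vanishes when `Tᵏ⁺¹M` is balanced. -/
theorem isCalabiYauTorsion_level (hμ : ∀ j, ContDiff ℝ ∞ (μ j)) (hpos : ∀ j x, 0 < μ j x) (k : ℕ)
    (h : ∀ j x, pd j (fun y => Real.log (μ j y)) x = 2 ^ k * pd j (logVolume μ) x) :
    IsCalabiYauTorsion (levelJ (diagData μ) (k + 2)) (levelMetric (diagData μ) (k + 2)) := by
  rw [levelJ_succ, levelMetric_succ]
  have hs := levelWeight_swap (μ := μ) (k + 1)
  have hm : ∀ a x, 0 < levelWeight μ (k + 1) a x := fun a x => hpos _ _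
  have hzero : ∀ b, (fun x => ∑ c, frameSign c * bismut (fun _ => stdJ)
      (fun y => Matrix.diagonal fun a => levelWeight μ (k + 1) a y) x b c c.swap) =
      fun _ => 0 := by
    intro b
    ext x
    rw [sum_frameSign_mul_bismut_diagonal _ hs hm]
    by_cases hb : ∃ j, Sum.inl (Idx.baseIdx (k + 1) j) = b.swap
    · obtain ⟨j, hj⟩ := hb
      have hr : b = Sum.inr (Idx.baseIdx (k + 1) j) := by
        rw [← Sum.swap_swap b, ← hj, Sum.swap_inl]
      rw [← hj, sum_logDeriv_levelWeight hμ hpos, logDeriv_levelWeight hμ hpos, hr, Sum.elim_inr,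
        Idx.root_baseIdx, h]
      ring
    · simp [pd_levelWeight_of_notMem hμ (k + 1) _ x (not_exists.1 hb)]
  intro x a b
  refine (ricciForm_bismut_diagonal _ hs hm (contDiff_levelWeight hμ (k + 1)) x a b).trans ?_
  rw [hzero, hzero]
  simp

/-- The balanced equations say that `(∏ μᵢ)^N / μⱼ` does not depend on `xⱼ`. The functions `fⱼ`
are the `(n N - 1)`-th roots of these quotients, and then `∏ fᵢ = ∏ μᵢ`. -/
theorem exists_factorization_iff (hμ : ∀ j, ContDiff ℝ ∞ (μ j)) (hpos : ∀ j x, 0 < μ j x)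
    (N : ℕ) (hN : 2 ≤ n * N) :
    (∀ j x, pd j (fun y => Real.log (μ j y)) x = N * pd j (logVolume μ) x) ↔
    ∃ f : Fin n → (Fin n → ℝ) → ℝ,
        (∀ j, ContDiff ℝ ∞ (f j)) ∧ (∀ j x, 0 < f j x) ∧
        ∀ j, (∀ x, pd j (f j) x = 0) ∧
          ∀ x, μ j x = (∏ i, f i x) ^ N / f j x ^ (n * N - 1) := by
  have hcast : ((n * N - 1 : ℕ) : ℝ) = n * N - 1 := by
    rw [Nat.cast_sub (by omega)]; simp
  -- `2 ≤ n * N` makes the order of the root nonzero.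
  have hne : (n * N - 1 : ℝ) ≠ 0 := by
    rw [← hcast]; exact_mod_cast (by omega : n * N - 1 ≠ 0)
  have hS := contDiff_logVolume hμ hpos
  constructor
  · intro h
    -- `u j = log (f j)` with `f j = ((∏ μᵢ)^N / μⱼ)^(1 / (n N - 1))`.
    let u : Fin n → (Fin n → ℝ) → ℝ := fun j x =>
      (n * N - 1 : ℝ)⁻¹ * (N * logVolume μ x - Real.log (μ j x))
    have hu : ∀ j, ContDiff ℝ ∞ (u j) := fun j =>
      contDiff_const.mul ((contDiff_const.mul hS).sub (contDiff_log hμ hpos j))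
    refine ⟨fun j x => Real.exp (u j x), fun j => (hu j).exp, fun j x => Real.exp_pos _,
      fun j => ⟨fun x => ?_, fun x => ?_⟩⟩
    · rw [pd_exp ((hu j).differentiable (by simp)).differentiableAt, pd_const_mul, pd_sub,
        pd_const_mul, h, sub_self, mul_zero, mul_zero]
      · exact ((contDiff_const.mul hS).differentiable (by simp)).differentiableAt
      · exact ((contDiff_log hμ hpos j).differentiable (by simp)).differentiableAt
    · have hsum : ∑ i, u i x = logVolume μ x := by
        simp only [u]
        rw [← Finset.mul_sum, Finset.sum_sub_distrib, Finset.sum_const, Finset.card_univ,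
          Fintype.card_fin, ← logVolume, nsmul_eq_mul]
        field_simp
      rw [← Real.exp_sum, hsum, ← Real.exp_nat_mul, ← Real.exp_nat_mul, ← Real.exp_sub, hcast]
      have hk : (n * N - 1 : ℝ) * u j x = N * logVolume μ x - Real.log (μ j x) :=
        mul_inv_cancel_left₀ hne _
      rw [hk, sub_sub_cancel, Real.exp_log (hpos j x)]
  · rintro ⟨f, hf, hfpos, H⟩ j x
    have hlog : ∀ j x, Real.log (μ j x) = N * logVolume f x - (n * N - 1) * Real.log (f j x) := by
      intro j x
      rw [(H j).2 x, Real.log_div, Real.log_pow, Real.log_pow, hcast, Real.log_prod]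
      · rfl
      · exact fun i _ => (hfpos i x).ne'
      · exact (pow_pos (Finset.prod_pos fun i _ => hfpos i x) _).ne'
      · exact (pow_pos (hfpos j x) _).ne'
    have hvol : logVolume μ = logVolume f := by
      ext x
      rw [logVolume]
      simp only [hlog]
      rw [Finset.sum_sub_distrib, ← Finset.mul_sum, Finset.sum_const, Finset.card_univ,
          Fintype.card_fin, nsmul_eq_mul, ← Finset.mul_sum]
      change _ - _ * logVolume f x = _
      ring
    simp only [hlog]
    rw [pd_sub, pd_const_mul, pd_const_mul,
      pd_log ((hf j).differentiable (by simp)).differentiableAt (hfpos j x).ne', (H j).1, hvol]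
    · ring
    · exact ((contDiff_const.mul (contDiff_logVolume hf hfpos)).differentiable
        (by simp)).differentiableAt
    · exact ((contDiff_const.mul (contDiff_log hf hfpos j)).differentiable
        (by simp)).differentiableAt

end Levels
end AffineRiemann

theorem mainTheorem10 (n k₀ : ℕ) (hk₀ : 1 ≤ k₀) (hdim : 2 ≤ n * 2 ^ (k₀ - 1))
    (μ : Fin n → (Fin n → ℝ) → ℝ) (hμ : ∀ j, ContDiff ℝ ∞ (μ j)) (hpos : ∀ j x, 0 < μ j x) :
    (AffineRiemann.IsBalanced
        (AffineRiemann.levelJ (AffineRiemann.diagData μ) k₀)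
        (AffineRiemann.levelMetric (AffineRiemann.diagData μ) k₀) ↔
      ∃ f : Fin n → (Fin n → ℝ) → ℝ,
        (∀ j, ContDiff ℝ ∞ (f j)) ∧ (∀ j x, 0 < f j x) ∧
        ∀ j, (∀ x, AffineRiemann.pd j (f j) x = 0) ∧
          ∀ x, μ j x = (∏ i, f i x) ^ (2 ^ (k₀ - 1)) / f j x ^ (n * 2 ^ (k₀ - 1) - 1)) ∧
    (AffineRiemann.IsBalanced
        (AffineRiemann.levelJ (AffineRiemann.diagData μ) k₀)
        (AffineRiemann.levelMetric (AffineRiemann.diagData μ) k₀) →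
      AffineRiemann.IsCalabiYauTorsion
        (AffineRiemann.levelJ (AffineRiemann.diagData μ) (k₀ + 1))
        (AffineRiemann.levelMetric (AffineRiemann.diagData μ) (k₀ + 1)) ∧
      ∀ k, 1 ≤ k → k ≠ k₀ →
        AffineRiemann.IsLocConfBalanced
          (AffineRiemann.levelJ (AffineRiemann.diagData μ) k)
          (AffineRiemann.levelMetric (AffineRiemann.diagData μ) k)) := by
  obtain ⟨m, rfl⟩ : ∃ m, k₀ = m + 1 := ⟨k₀ - 1, by omega⟩
  have hiff := AffineRiemann.isBalanced_level_iff hμ hpos m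
  refine ⟨hiff.trans ?_, fun hb => ⟨?_, fun k hk _ => ?_⟩⟩
  · have := AffineRiemann.exists_factorization_iff hμ hpos (2 ^ m) hdim
    rwa [Nat.cast_pow, Nat.cast_ofNat] at this
  · exact AffineRiemann.isCalabiYauTorsion_level hμ hpos m (hiff.1 hb)
  · obtain ⟨l, rfl⟩ : ∃ l, k = l + 1 := ⟨k - 1, by omega⟩
    exact AffineRiemann.isLocConfBalanced_level hμ hpos (hiff.1 hb) l
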